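/- Let $m\ge r$ be natural numbers, let $P$ be a positive definite Hermitian complex $m\times m$ matrix, and let $Z$ be a random complex $m\times r$ matrix with the central complex matrix-variate normal law $mN^{\mathbb C}(0,I_r,P)$, that is, with density $$f_Z(Z)=\pi^{-mr}\,|P|^{-r}\exp\bigl(-\operatorname{tr}(\bar Z'P^{-1}Z)\bigr)$$ with respect to Lebesgue measure on $\mathbb C^{m\times r}\cong\mathbb R^{2mr}$, where $|\cdot|$ is the determinant and $\bar Z'$ the conjugate transpose. Let $V^{\mathbb C}_{r,m}=\{X\in\mathbb C^{m\times r}:\bar X'X=I_r\}$ be the complex Stiefel manifold, and let $[dX]$ be its normalized invariant measure, i.e. the unique Borel probability measure on $V^{\mathbb C}_{r,m}$ that is invariant under $X\mapsto UX$ for every unitary $m\times m$ matrix $U$. Then almost surely $Z$ has rank $r$ and its orientation $H_Z=Z(\bar Z'Z)^{-1/2}$ lies in $V^{\mathbb C}_{r,m}$. The law of $H_Z$, which is called the complex matrix angular central Gaussian distribution $CMACG(P)$, is concentrated on $V^{\mathbb C}_{r,m}$ and has there, with respect to $[dX]$, the density $$f_{H_Z}(X)=|P|^{-r}\,\bigl|\bar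 X'P^{-1}X\bigr|^{-m},\qquad X\in V^{\mathbb C}_{r,m}.$$ -/

import Mathlib

open MeasureTheory ProbabilityTheory Matrix
open scoped ComplexOrder MatrixOrder ENNReal

noncomputable section

namespace CMACG

/-! ### Complex matrices as a measure space -/

/-- Lebesgue measure `(dZ)` on complex `m × r` matrices: the product, over all entries, of the
Lebesgue measure on `ℂ ≅ ℝ²`. -/
instance instMeasureSpaceMatrix (m r : ℕ) : MeasureSpace (Matrix (Fin m) (Fin r) ℂ) :=
  inferInstanceAs (MeasureSpace (Fin m → Fin r → ℂ))

instance instBorelSpaceMatrix (m r : ℕ) : BorelSpace (Matrix (Fin m) (Fin r) ℂ) :=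
  inferInstanceAs (BorelSpace (Fin m → Fin r → ℂ))

instance instSecondCountableMatrix (m r : ℕ) :
    SecondCountableTopology (Matrix (Fin m) (Fin r) ℂ) :=
  inferInstanceAs (SecondCountableTopology (Fin m → Fin r → ℂ))

/-- The unitary group `U(m)` is compact. -/
instance instCompactUnitary (m : ℕ) : CompactSpace (unitaryGroup (Fin m) ℂ) := by
  refine isCompact_iff_compactSpace.mp ?_
  have hK : IsCompact (Set.pi Set.univ fun _ : Fin m => Set.pi Set.univ fun _ : Fin m =>
      Metric.closedBall (0 : ℂ) 1) :=
    isCompact_univ_pi fun _ => isCompact_univ_pi fun _ => isCompact_closedBall _ _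
  have hcl : IsClosed ((unitaryGroup (Fin m) ℂ : Set (Matrix (Fin m) (Fin m) ℂ))) :=
    isClosed_unitary
  refine IsCompact.of_isClosed_subset (X := Matrix (Fin m) (Fin m) ℂ) hK hcl ?_
  intro U hU i _ j _
  simpa using entry_norm_bound_of_unitary hU i j

/-! ### The complex Stiefel manifold and its normalized invariant measure -/

/-- The complex Stiefel manifold `V_{r,m}^ℂ`: the `m × r` matrices with `X̄' X = I_r`. -/
def stiefel (m r : ℕ) : Set (Matrix (Fin m) (Fin r) ℂ) := {X | Xᴴ * X = 1}

/-- The left action `X ↦ U X` of the unitary group `U(m)` on the Stiefel manifold. -/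
def rotate {m r : ℕ} (U : unitaryGroup (Fin m) ℂ) (X : stiefel m r) : stiefel m r :=
  ⟨U.1 * X.1, by
    have hU : U.1ᴴ * U.1 = 1 := mem_unitaryGroup_iff'.mp U.2
    have hX : X.1ᴴ * X.1 = 1 := X.2
    change (U.1 * X.1)ᴴ * (U.1 * X.1) = 1
    rw [conjTranspose_mul, Matrix.mul_assoc, ← Matrix.mul_assoc _ U.1, hU, Matrix.one_mul, hX]⟩

/-- The first `r` columns of a unitary `m × m` matrix form a point of the Stiefel manifold. -/
def firstColumns {m r : ℕ} (h : r ≤ m) (U : unitaryGroup (Fin m) ℂ) : stiefel m r :=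
  ⟨U.1.submatrix id (Fin.castLE h), by
    have hU : U.1ᴴ * U.1 = 1 := mem_unitaryGroup_iff'.mp U.2
    change (U.1.submatrix id (Fin.castLE h))ᴴ * (U.1.submatrix id (Fin.castLE h)) = 1
    rw [conjTranspose_submatrix, ← submatrix_mul _ _ _ _ _ Function.bijective_id, hU]
    exact submatrix_one _ (Fin.castLE_injective h)⟩

/-- The Haar probability measure on the unitary group `U(m)`. -/
def unitaryHaar (m : ℕ) : Measure (unitaryGroup (Fin m) ℂ) := Measure.haarMeasure ⊤

/-- The normalized invariant measure `[dX]` on the complex Stiefel manifold: the law of the first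
`r` columns of a Haar distributed unitary matrix. By `map_rotate_stiefelMeasure` and
`eq_stiefelMeasure` below it is the one and only probability measure on the manifold that is
invariant under the transformations `X ↦ U X` with `U` unitary. -/
def stiefelMeasure {m r : ℕ} (h : r ≤ m) : Measure (stiefel m r) :=
  (unitaryHaar m).map (firstColumns h)

lemma measurable_firstColumns {m r : ℕ} (h : r ≤ m) : Measurable (firstColumns h) := by
  apply Continuous.measurable
  unfold firstColumns
  fun_prop

lemma measurable_rotate_uncurry (m r : ℕ) :
    Measurable fun p : unitaryGroup (Fin m) ℂ × stiefel m r => rotate p.1 p.2 := by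
  apply Continuous.measurable
  unfold rotate
  fun_prop

lemma measurable_rotate {m r : ℕ} (U : unitaryGroup (Fin m) ℂ) :
    Measurable (rotate U : stiefel m r → stiefel m r) :=
  (measurable_rotate_uncurry m r).comp (measurable_const.prodMk measurable_id)

lemma rotate_firstColumns {m r : ℕ} (h : r ≤ m) (U V : unitaryGroup (Fin m) ℂ) :
    rotate U (firstColumns h V) = firstColumns h (U * V) := by
  apply Subtype.ext
  ext i j
  simp [rotate, firstColumns, Matrix.mul_apply]

instance instUnitaryHaarProb (m : ℕ) : IsProbabilityMeasure (unitaryHaar m) :=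
  ⟨Measure.haarMeasure_self⟩

instance instUnitaryHaarIsHaar (m : ℕ) : (unitaryHaar m).IsHaarMeasure := by
  unfold unitaryHaar; infer_instance

instance instUnitaryHaarRight (m : ℕ) : (unitaryHaar m).IsMulRightInvariant :=
  ⟨fun V => by
    have := Measure.isProbabilityMeasure_map (μ := unitaryHaar m)
      (measurable_mul_const V).aemeasurable
    have : (Measure.map (fun x => x * V) (unitaryHaar m)).IsHaarMeasure := inferInstance
    exact Measure.isHaarMeasure_eq_of_isProbabilityMeasure _ _⟩

instance instStiefelMeasureProb {m r : ℕ} (h : r ≤ m) : IsProbabilityMeasure (stiefelMeasure h) :=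
  Measure.isProbabilityMeasure_map (measurable_firstColumns h).aemeasurable

lemma map_rotate_stiefelMeasure {m r : ℕ} (h : r ≤ m) (U : unitaryGroup (Fin m) ℂ) :
    (stiefelMeasure h).map (rotate U) = stiefelMeasure h := by
  unfold stiefelMeasure
  rw [Measure.map_map (measurable_rotate U) (measurable_firstColumns h)]
  have : rotate U ∘ firstColumns h = firstColumns h ∘ (U * ·) :=
    funext fun V => rotate_firstColumns h U V
  rw [this, ← Measure.map_map (measurable_firstColumns h) (measurable_const_mul U),
    map_mul_left_eq_self]

lemma firstColumns_surjective {m r : ℕ} (h : r ≤ m) : Function.Surjective (firstColumns h) := by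
  intro X
  have hX : X.1ᴴ * X.1 = 1 := X.2
  classical
  let v : Fin m → EuclideanSpace ℂ (Fin m) := fun j =>
    if hj : j.1 < r then WithLp.toLp 2 (fun i => X.1 i ⟨j.1, hj⟩) else 0
  let s : Set (Fin m) := {j | j.1 < r}
  have hv : Orthonormal ℂ (s.domRestrict v) := by
    rw [orthonormal_iff_ite]
    rintro ⟨i, hi⟩ ⟨j, hj⟩
    have hi' : i.1 < r := hi
    have hj' : j.1 < r := hj
    have := congrFun (congrFun hX ⟨i.1, hi'⟩) ⟨j.1, hj'⟩
    simp only [Matrix.mul_apply, conjTranspose_apply, Matrix.one_apply, Fin.mk.injEq] at this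
    simp only [Subtype.mk.injEq, Fin.ext_iff]
    rw [← this]
    change inner ℂ (v i) (v j) = _
    simp only [v, hi', hj', dite_true, PiLp.inner_apply, RCLike.inner_apply]
    exact Finset.sum_congr rfl fun k _ => mul_comm _ _
  obtain ⟨b, hb⟩ := hv.exists_orthonormalBasis_extension_of_card_eq (by simp)
  let W : Matrix (Fin m) (Fin m) ℂ := Matrix.of fun i j => b j i
  have hW : W ∈ unitaryGroup (Fin m) ℂ := by
    rw [mem_unitaryGroup_iff']
    ext i j
    have := orthonormal_iff_ite.mp b.orthonormal i j
    simp only [PiLp.inner_apply, RCLike.inner_apply] at this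
    rw [Matrix.one_apply, ← this]
    simp only [W, star_eq_conjTranspose, Matrix.mul_apply, conjTranspose_apply, Matrix.of_apply]
    exact Finset.sum_congr rfl fun k _ => mul_comm _ _
  refine ⟨⟨W, hW⟩, Subtype.ext ?_⟩
  ext i j
  have hj : (Fin.castLE h j) ∈ s := j.2
  simp only [firstColumns, W, Matrix.submatrix_apply, Matrix.of_apply, hb _ hj, id]
  simp [v]

lemma eq_stiefelMeasure {m r : ℕ} (h : r ≤ m) (ν : Measure (stiefel m r)) [IsProbabilityMeasure ν]
    (hν : ∀ U : unitaryGroup (Fin m) ℂ, ν.map (rotate U) = ν) : ν = stiefelMeasure h := by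
  ext A hA
  have hmeas := measurable_rotate_uncurry m r
  have hS := hmeas hA
  have h1 : ((unitaryHaar m).prod ν)
      ((fun p : unitaryGroup (Fin m) ℂ × stiefel m r => rotate p.1 p.2) ⁻¹' A) = ν A := by
    rw [Measure.prod_apply hS]
    have : ∀ U : unitaryGroup (Fin m) ℂ, ν (Prod.mk U ⁻¹'
        ((fun p : unitaryGroup (Fin m) ℂ × stiefel m r => rotate p.1 p.2) ⁻¹' A)) = ν A := by
      intro U
      conv_rhs => rw [← hν U, Measure.map_apply (measurable_rotate U) hA]
      rfl
    simp [this]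
  have h2 : ((unitaryHaar m).prod ν)
      ((fun p : unitaryGroup (Fin m) ℂ × stiefel m r => rotate p.1 p.2) ⁻¹' A)
        = stiefelMeasure h A := by
    rw [Measure.prod_apply_symm hS]
    have : ∀ X : stiefel m r, unitaryHaar m ((fun U => (U, X)) ⁻¹'
        ((fun p : unitaryGroup (Fin m) ℂ × stiefel m r => rotate p.1 p.2) ⁻¹' A))
          = stiefelMeasure h A := by
      intro X
      obtain ⟨V, rfl⟩ := firstColumns_surjective h X
      rw [stiefelMeasure, Measure.map_apply (measurable_firstColumns h) hA]
      conv_rhs => rw [← map_mul_right_eq_self (unitaryHaar m) V,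
        Measure.map_apply (measurable_mul_const V) (measurable_firstColumns h hA)]
      congr 1
    simp [this]
  rw [← h1, h2]

/-! ### The complex matrix normal law, the orientation, and the density -/

/-- The central complex matrix normal law `mN^ℂ(0, I_r, P)` on `m × r` matrices, with density
`π^{-mr} |P|^{-r} exp(-tr(Z̄' P⁻¹ Z))` with respect to Lebesgue measure. For positive definite `P`
the determinant and the trace are real, so taking real parts changes nothing. -/
def complexMatrixNormal (m r : ℕ) (P : Matrix (Fin m) (Fin m) ℂ) :
    Measure (Matrix (Fin m) (Fin r) ℂ) :=
  volume.withDensity fun Z => ENNReal.ofReal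
    ((Real.pi ^ (m * r))⁻¹ * (P.det.re ^ r)⁻¹ * Real.exp (-(Zᴴ * P⁻¹ * Z).trace.re))

/-- The orientation `H_Z = Z (Z̄' Z)^{-1/2}`, with the positive semidefinite square root. (It has
its meaning for `Z` of full column rank.) -/
def orientation {m r : ℕ} (Z : Matrix (Fin m) (Fin r) ℂ) : Matrix (Fin m) (Fin r) ℂ :=
  Z * (CFC.sqrt (Zᴴ * Z))⁻¹

/-- The distribution `CMACG(P)` on `m × r` matrices: the law of the orientation of a random matrix
with the law `mN^ℂ(0, I_r, P)`. -/
def cmacg (m r : ℕ) (P : Matrix (Fin m) (Fin m) ℂ) : Measure (Matrix (Fin m) (Fin r) ℂ) :=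
  (complexMatrixNormal m r P).map orientation

/-- The function `|P|^{-r} |X̄' P⁻¹ X|^{-m}`. Both determinants are positive reals when `P` is
positive definite and `X` lies on the Stiefel manifold, see `cmacgDensity_eq`. -/
def cmacgDensity {m r : ℕ} (P : Matrix (Fin m) (Fin m) ℂ) (X : Matrix (Fin m) (Fin r) ℂ) : ℝ :=
  (P.det.re ^ r)⁻¹ * ((Xᴴ * P⁻¹ * X).det.re ^ m)⁻¹

lemma cmacgDensity_eq {m r : ℕ} {P : Matrix (Fin m) (Fin m) ℂ} (hP : P.PosDef) (X : stiefel m r) :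
    0 < cmacgDensity P X.1 ∧
      ((cmacgDensity P X.1 : ℝ) : ℂ) = (P.det ^ r)⁻¹ * ((X.1ᴴ * P⁻¹ * X.1).det ^ m)⁻¹ := by
  have hX : X.1ᴴ * X.1 = 1 := X.2
  have hinj : Function.Injective X.1.mulVec := by
    intro a b hab
    have := congrArg (X.1ᴴ.mulVec) hab
    simpa [Matrix.mulVec_mulVec, hX] using this
  have hQ : (X.1ᴴ * P⁻¹ * X.1).PosDef := hP.inv.conjTranspose_mul_mul_same hinj
  have h1 := Complex.pos_iff.mp hP.det_pos
  have h2 := Complex.pos_iff.mp hQ.det_pos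
  have e1 : ((P.det.re : ℝ) : ℂ) = P.det := Complex.ext (by simp) (by simp [h1.2])
  have e2 : (((X.1ᴴ * P⁻¹ * X.1).det.re : ℝ) : ℂ) = (X.1ᴴ * P⁻¹ * X.1).det :=
    Complex.ext (by simp) (by simp [h2.2])
  refine ⟨?_, ?_⟩
  · have := h1.1
    have := h2.1
    unfold cmacgDensity
    positivity
  · unfold cmacgDensity
    push_cast
    rw [e1, e2]

end CMACG

end

/-!
The idea is to compare two Gaussian integrals by the symmetries of the matrix space, so that no
Jacobian of the polar decomposition is needed. Write `R = P⁻¹` and `e_R(Z) = exp (-tr (Z̄'RZ))`.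

For `P = I` the normal law is invariant under `Z ↦ U Z` with `U` unitary, and
`H_{UZ} = U H_Z`. The law of the orientation is then an invariant probability measure on the
Stiefel manifold, and uniqueness identifies it with `stiefelMeasure`
(`lintegral_orientation_mul_gaussWeight_one`).

For general `P` it remains to show that
`∫ ψ(H_Z) e_R(Z) dZ = ∫ ψ(H_Z) |Z̄'RZ|^{-m} |Z̄'Z|^m e_I(Z) dZ` for every `ψ ≥ 0`; indeed
`|H̄_Z' R H_Z| = |Z̄'RZ| |Z̄'Z|^{-1}` (`gramDet_orientation`). Both weights are invariant under
`Z ↦ Z U` with `U` in `U(r)`, and `H_{ZU} = H_Z U`, so `ψ(H_Z)` may be averaged over `U(r)`. The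
average `φ(Z)` depends only on the column space of `Z`, that is, `φ(ZT) = φ(Z)` for `T` in
`GL_r(ℂ)` (`lintegral_orientation_mul_gaussWeight`).

For such `φ`, with `dT / |det T|^{2r}` the invariant measure of `GL_r(ℂ)`, consider
`∫∫ φ(Z) |Z̄'Z|^m e_R(Z) e_I(ZT) |det T|^{2m} dZ dT / |det T|^{2r}`.
Integrating over `T` first gives a constant times `∫ φ e_R`. The substitution `Z ↦ Z T⁻¹`, whose
Jacobian is `|det T|^{-2m}`, followed by integration over `T` gives a constant times
`∫ φ |Z̄'RZ|^{-m} |Z̄'Z|^m e_I` (`gaussConst_mul_lintegral`). The constants do not depend on `R`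
and `φ`; the case `R = I`, `φ = 1` shows that they are equal, and they are positive and, because
`r ≤ m`, finite.

Almost sure full rank holds because on suitable parallel complex lines the determinant of a
maximal minor is a nonzero polynomial (`ae_det_conjTranspose_mul_self_ne_zero`), and measurability
of the orientation follows from the Lusin-Souslin theorem (`measurable_orientation`).
-/

noncomputable section

namespace CMACG

/-! ### Lebesgue measure on complex matrices and linear substitutions -/

instance instIsAddHaarMeasureMatrix (m r : ℕ) :
    Measure.IsAddHaarMeasure (volume : Measure (Matrix (Fin m) (Fin r) ℂ)) :=
  (Measure.pi.isAddHaarMeasure _ :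
    Measure.IsAddHaarMeasure (volume : Measure (Fin m → Fin r → ℂ)))

instance instSigmaFiniteMatrix (m r : ℕ) :
    SigmaFinite (volume : Measure (Matrix (Fin m) (Fin r) ℂ)) :=
  inferInstanceAs (SigmaFinite (volume : Measure (Fin m → Fin r → ℂ)))

instance instPolishSpaceMatrix (m r : ℕ) : PolishSpace (Matrix (Fin m) (Fin r) ℂ) :=
  inferInstanceAs (PolishSpace (Fin m → Fin r → ℂ))

lemma det_mulRightLinearMap {m r : ℕ} (T : Matrix (Fin r) (Fin r) ℂ) :
    LinearMap.det (mulRightLinearMap (Fin m) ℂ T) = T.det ^ m := by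
  have h1 : (mulRightLinearMap (Fin m) ℂ T) =
      LinearMap.pi (fun i : Fin m => (Matrix.vecMulLinear T).comp (LinearMap.proj i)) := by
    ext Z i j
    rfl
  have h2 : LinearMap.det (Matrix.vecMulLinear T) = T.det := by
    have h3 : Matrix.vecMulLinear T = Matrix.toLin' Tᵀ := by
      ext
      simp [Matrix.toLin'_apply]
    rw [h3, LinearMap.det_toLin', det_transpose]
  rw [h1]
  refine (LinearMap.det_pi _).trans ?_
  simp [h2]

lemma det_mulLeftLinearMap {m r : ℕ} (A : Matrix (Fin m) (Fin m) ℂ) :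
    LinearMap.det (mulLeftLinearMap (Fin r) ℂ A) = A.det ^ r := by
  have h1 := LinearMap.det_conj (mulLeftLinearMap (Fin r) ℂ A)
    (Matrix.transposeLinearEquiv (Fin m) (Fin r) ℂ ℂ)
  rw [← h1, ← det_transpose A, ← det_mulRightLinearMap (m := r) Aᵀ]
  congr 1
  ext Z i j
  change ((A * Zᵀ)ᵀ) i j = (Z * Aᵀ) i j
  rw [transpose_mul, transpose_transpose]

/-- Change of variables for a complex linear automorphism: its Jacobian as a real map is the
squared modulus of its complex determinant. -/
lemma lintegral_comp_linearMap {m r : ℕ}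
    (f : Matrix (Fin m) (Fin r) ℂ →ₗ[ℂ] Matrix (Fin m) (Fin r) ℂ) (hf : LinearMap.det f ≠ 0)
    (F : Matrix (Fin m) (Fin r) ℂ → ℝ≥0∞) :
    ENNReal.ofReal (‖LinearMap.det f‖ ^ 2) * ∫⁻ Z, F (f Z) = ∫⁻ Z, F Z := by
  have hd : LinearMap.det (f.restrictScalars ℝ) = ‖LinearMap.det f‖ ^ 2 := by
    rw [LinearMap.det_restrictScalars, Algebra.norm_complex_apply, Complex.normSq_eq_norm_sq]
  have hpos : 0 < ‖LinearMap.det f‖ ^ 2 := by positivity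
  -- As a normed space, the matrix space is the iterated product of copies of `ℂ`.
  let g : (Fin m → Fin r → ℂ) →ₗ[ℝ] (Fin m → Fin r → ℂ) := f.restrictScalars ℝ
  let G : (Fin m → Fin r → ℂ) → ℝ≥0∞ := F
  have hg : LinearMap.det g = ‖LinearMap.det f‖ ^ 2 := hd
  have : Measure.IsAddHaarMeasure (volume : Measure (Fin m → Fin r → ℂ)) :=
    Measure.pi.isAddHaarMeasure _
  have hmap := Measure.map_linearMap_addHaar_eq_smul_addHaar
    (volume : Measure (Fin m → Fin r → ℂ)) (f := g) (by rw [hg]; exact hpos.ne')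
  have hemb : MeasurableEmbedding g :=
    (LinearMap.continuous_of_finiteDimensional g).measurableEmbedding
      (LinearMap.equivOfDetNeZero f hf).injective
  have h2 := hemb.lintegral_map G (μ := volume)
  rw [hmap, lintegral_smul_measure, hg, smul_eq_mul, abs_of_pos (inv_pos.mpr hpos)] at h2
  change _ = ∫⁻ Z, F (f Z) at h2
  rw [← h2, ← mul_assoc, ← ENNReal.ofReal_mul hpos.le, mul_inv_cancel₀ hpos.ne',
    ENNReal.ofReal_one, one_mul]
  rfl

lemma lintegral_comp_mul_right {m r : ℕ} {T : Matrix (Fin r) (Fin r) ℂ} (hT : T.det ≠ 0)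
    (F : Matrix (Fin m) (Fin r) ℂ → ℝ≥0∞) :
    ENNReal.ofReal (‖T.det‖ ^ (2 * m)) * ∫⁻ Z : Matrix (Fin m) (Fin r) ℂ, F (Z * T) = ∫⁻ Z, F Z := by
  have := lintegral_comp_linearMap (mulRightLinearMap (Fin m) ℂ T)
    (by rw [det_mulRightLinearMap]; exact pow_ne_zero _ hT) F
  rwa [det_mulRightLinearMap, norm_pow, ← pow_mul, mul_comm m 2] at this

lemma lintegral_comp_mul_left {m r : ℕ} {A : Matrix (Fin m) (Fin m) ℂ} (hA : A.det ≠ 0)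
    (F : Matrix (Fin m) (Fin r) ℂ → ℝ≥0∞) :
    ENNReal.ofReal (‖A.det‖ ^ (2 * r)) * ∫⁻ Z : Matrix (Fin m) (Fin r) ℂ, F (A * Z) = ∫⁻ Z, F Z := by
  have := lintegral_comp_linearMap (mulLeftLinearMap (Fin r) ℂ A)
    (by rw [det_mulLeftLinearMap]; exact pow_ne_zero _ hA) F
  rwa [det_mulLeftLinearMap, norm_pow, ← pow_mul, mul_comm r 2] at this

/-- Lebesgue almost every `m × r` matrix with `r ≤ m` has full column rank: along the line through
any matrix in the direction of `(I_r, 0)'`, the determinant of the upper `r × r` block is a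
nonzero polynomial, so it has only finitely many zeros. -/
lemma ae_det_conjTranspose_mul_self_ne_zero {m r : ℕ} (h : r ≤ m) :
    ∀ᵐ Z : Matrix (Fin m) (Fin r) ℂ, (Zᴴ * Z).det ≠ 0 := by
  let top : (Fin m → Fin r → ℂ) → Matrix (Fin r) (Fin r) ℂ :=
    fun Z => Matrix.of fun i j => Z (Fin.castLE h i) j
  have hs : MeasurableSet {Z | (top Z).det ≠ 0} := by
    have : Measurable fun Z => (top Z).det := by
      refine Continuous.measurable (Continuous.matrix_det ?_)
      exact continuous_matrix fun i j => by simp only [top, Matrix.of_apply]; fun_prop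
    exact this (measurableSet_singleton 0).compl
  let E : Fin m → Fin r → ℂ := fun i j => if i = Fin.castLE h j then 1 else 0
  have hE : top E = 1 := by
    ext i j
    simp [top, E, Matrix.one_apply]
  have : Measure.IsAddHaarMeasure (volume : Measure (Fin m → Fin r → ℂ)) :=
    Measure.pi.isAddHaarMeasure _
  have hae := ae_mem_of_ae_add_linearMap_mem 
    (LinearMap.toSpanSingleton ℂ (Fin m → Fin r → ℂ) E) (volume : Measure ℂ)
    (volume : Measure (Fin m → Fin r → ℂ)) hs (by
      intro Y
      have hsub : {t : ℂ | ¬ (Y + LinearMap.toSpanSingleton ℂ (Fin m → Fin r → ℂ) E t ∈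
          {Z | (top Z).det ≠ 0})} ⊆
            {t | (-(top Y)).charpoly.IsRoot t} := by
        intro t ht
        replace ht : (top (Y + LinearMap.toSpanSingleton ℂ (Fin m → Fin r → ℂ) E t)).det = 0 :=
          not_not.mp ht
        rw [Set.mem_ofPred_eq, Polynomial.IsRoot, Matrix.eval_charpoly, ← ht]
        congr 1
        have : top (Y + LinearMap.toSpanSingleton ℂ (Fin m → Fin r → ℂ) E t) =
            top Y + t • top E := rfl
        rw [this, hE]
        simp [add_comm, Matrix.smul_one_eq_diagonal, Matrix.scalar_apply]
      refine measure_mono_null hsub (Set.Finite.measure_zero ?_ _)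
      exact Polynomial.finite_setOfPred_isRoot (Matrix.charpoly_monic _).ne_zero)
  filter_upwards [hae] with Z hZ
  intro h0
  obtain ⟨v, hv, hv0⟩ := Matrix.exists_mulVec_eq_zero_iff.mpr h0
  have hZv : Z *ᵥ v = 0 := (Matrix.conjTranspose_mul_self_mulVec_eq_zero Z v).mp hv0
  refine hZ (Matrix.exists_mulVec_eq_zero_iff.mp ⟨v, hv, ?_⟩)
  ext i
  exact congrFun hZv (Fin.castLE h i)

/-- The invariant measure `dT / |det T|^{2r}` of the group `GL_r(ℂ)`, as a measure on all `r × r`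
matrices. The density takes the junk value `0` on the singular matrices, so these form a null set
by construction. -/
def glMeasure (r : ℕ) : Measure (Matrix (Fin r) (Fin r) ℂ) :=
  volume.withDensity fun T => ENNReal.ofReal ((‖T.det‖ ^ (2 * r))⁻¹)

lemma measurable_glDensity (r : ℕ) : Measurable fun T : Matrix (Fin r) (Fin r) ℂ =>
    ENNReal.ofReal ((‖T.det‖ ^ (2 * r))⁻¹) := by
  have : Measurable fun T : Matrix (Fin r) (Fin r) ℂ => T.det :=
    Continuous.measurable (by fun_prop)
  fun_prop

instance instSFiniteGlMeasure (r : ℕ) : SFinite (glMeasure r) := by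
  unfold glMeasure
  infer_instance

lemma lintegral_glMeasure {r : ℕ} (F : Matrix (Fin r) (Fin r) ℂ → ℝ≥0∞) :
    ∫⁻ T, F T ∂glMeasure r = ∫⁻ T, ENNReal.ofReal ((‖T.det‖ ^ (2 * r))⁻¹) * F T :=
  lintegral_withDensity_eq_lintegral_mul_non_measurable _ (measurable_glDensity r)
    (Filter.Eventually.of_forall fun _ => ENNReal.ofReal_lt_top) _

lemma ae_glMeasure_det_ne_zero (r : ℕ) : ∀ᵐ T ∂glMeasure r, T.det ≠ 0 := by
  unfold glMeasure
  rw [ae_withDensity_iff (measurable_glDensity r)]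
  refine Filter.Eventually.of_forall fun T hT h0 => hT ?_
  rcases Nat.eq_zero_or_pos r with rfl | hr
  · simp at h0
  · rw [h0]
    simp [hr.ne']

lemma lintegral_glMeasure_mul_left {r : ℕ} {B : Matrix (Fin r) (Fin r) ℂ} (hB : B.det ≠ 0)
    (F : Matrix (Fin r) (Fin r) ℂ → ℝ≥0∞) :
    ∫⁻ T, F (B * T) ∂glMeasure r = ∫⁻ T, F T ∂glMeasure r := by
  rw [lintegral_glMeasure, lintegral_glMeasure, ← lintegral_comp_mul_left hB (fun T => _ * F T),
    ← lintegral_const_mul' _ _ ENNReal.ofReal_ne_top]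
  refine lintegral_congr fun T => ?_
  rw [← mul_assoc, ← ENNReal.ofReal_mul (by positivity)]
  have : ‖B.det‖ ^ (2 * r) ≠ 0 := pow_ne_zero _ (norm_ne_zero_iff.mpr hB)
  rw [det_mul, norm_mul, mul_pow, mul_inv, mul_inv_cancel_left₀ this]

lemma lintegral_glMeasure_mul_right {r : ℕ} {B : Matrix (Fin r) (Fin r) ℂ} (hB : B.det ≠ 0)
    (F : Matrix (Fin r) (Fin r) ℂ → ℝ≥0∞) :
    ∫⁻ T, F (T * B) ∂glMeasure r = ∫⁻ T, F T ∂glMeasure r := by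
  rw [lintegral_glMeasure, lintegral_glMeasure, ← lintegral_comp_mul_right hB (fun T => _ * F T),
    ← lintegral_const_mul' _ _ ENNReal.ofReal_ne_top]
  refine lintegral_congr fun T => ?_
  rw [← mul_assoc, ← ENNReal.ofReal_mul (by positivity)]
  have : ‖B.det‖ ^ (2 * r) ≠ 0 := pow_ne_zero _ (norm_ne_zero_iff.mpr hB)
  rw [det_mul, norm_mul, mul_pow, mul_comm (‖T.det‖ ^ _), mul_inv, mul_inv_cancel_left₀ this]

/-! ### Gaussian weights and determinants of Gram matrices -/

/-- The Gaussian weight `exp (-tr (Z̄' R Z))`, without normalization. -/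
def gaussWeight {m r : ℕ} (R : Matrix (Fin m) (Fin m) ℂ) (Z : Matrix (Fin m) (Fin r) ℂ) : ℝ≥0∞ :=
  ENNReal.ofReal (Real.exp (-(Zᴴ * R * Z).trace.re))

/-- The Gram determinant `|Z̄' R Z|`. It is real for Hermitian `R`, so that taking the real part
changes nothing. -/
def gramDet {m r : ℕ} (R : Matrix (Fin m) (Fin m) ℂ) (Z : Matrix (Fin m) (Fin r) ℂ) : ℝ :=
  (Zᴴ * R * Z).det.re

lemma measurable_gaussWeight {m r : ℕ} (R : Matrix (Fin m) (Fin m) ℂ) :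
    Measurable (gaussWeight R : Matrix (Fin m) (Fin r) ℂ → ℝ≥0∞) := by
  have : Measurable fun Z : Matrix (Fin m) (Fin r) ℂ => (Zᴴ * R * Z).trace.re :=
    Continuous.measurable (by fun_prop)
  exact this.neg.exp.ennreal_ofReal

lemma measurable_gramDet {m r : ℕ} (R : Matrix (Fin m) (Fin m) ℂ) :
    Measurable (gramDet R : Matrix (Fin m) (Fin r) ℂ → ℝ) :=
  Continuous.measurable (by unfold gramDet; fun_prop)

lemma measurable_matrix_inv (r : ℕ) : Measurable fun T : Matrix (Fin r) (Fin r) ℂ => T⁻¹ := by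
  have h1 : Measurable fun T : Matrix (Fin r) (Fin r) ℂ => T.det :=
    Continuous.measurable (by fun_prop)
  have h2 : Measurable fun T : Matrix (Fin r) (Fin r) ℂ => T.adjugate :=
    Continuous.measurable (by fun_prop)
  have h3 : Measurable fun p : ℂ × Matrix (Fin r) (Fin r) ℂ => p.1 • p.2 :=
    Continuous.measurable (by fun_prop)
  simp_rw [Matrix.inv_def, Ring.inverse_eq_inv']
  exact h3.comp (h1.inv.prodMk h2)

lemma gramDet_eq_norm_det_sq {m r : ℕ} {R : Matrix (Fin m) (Fin m) ℂ}
    {Z : Matrix (Fin m) (Fin r) ℂ} {B : Matrix (Fin r) (Fin r) ℂ} (hB : Zᴴ * R * Z = Bᴴ * B) :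
    gramDet R Z = ‖B.det‖ ^ 2 := by
  rw [gramDet, hB, det_mul, det_conjTranspose, Complex.star_def, ← Complex.normSq_eq_conj_mul_self,
    Complex.ofReal_re, Complex.normSq_eq_norm_sq]

/-- The Gram matrix of a matrix of full column rank has a nonsingular factor. -/
lemma exists_gram_eq_conjTranspose_mul_self {m r : ℕ} {R : Matrix (Fin m) (Fin m) ℂ}
    (hR : R.PosDef) {Z : Matrix (Fin m) (Fin r) ℂ} (hZ : (Zᴴ * Z).det ≠ 0) :
    ∃ B : Matrix (Fin r) (Fin r) ℂ, Zᴴ * R * Z = Bᴴ * B ∧ B.det ≠ 0 := by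
  have hinj : Function.Injective Z.mulVec := by
    have hu : IsUnit (Zᴴ * Z) := (Matrix.isUnit_iff_isUnit_det _).mpr hZ.isUnit
    have := Matrix.mulVec_injective_of_isUnit hu
    intro v w hvw
    refine this ?_
    simp only [← Matrix.mulVec_mulVec, hvw]
  have hQ : (Zᴴ * R * Z).PosDef := hR.conjTranspose_mul_mul_same hinj
  obtain ⟨B, hB⟩ := CStarAlgebra.nonneg_iff_eq_star_mul_self.mp hQ.posSemidef.nonneg
  rw [star_eq_conjTranspose] at hB
  refine ⟨B, hB, fun h0 => hQ.det_pos.ne' ?_⟩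
  rw [hB, det_mul, h0, mul_zero]

lemma gramDet_pos {m r : ℕ} {R : Matrix (Fin m) (Fin m) ℂ}
    (hR : R.PosDef) {Z : Matrix (Fin m) (Fin r) ℂ} (hZ : (Zᴴ * Z).det ≠ 0) : 0 < gramDet R Z := by
  obtain ⟨B, hB, hd⟩ := exists_gram_eq_conjTranspose_mul_self hR hZ
  rw [gramDet_eq_norm_det_sq hB]
  positivity

lemma gramDet_mul {m r : ℕ} (R : Matrix (Fin m) (Fin m) ℂ) (Z : Matrix (Fin m) (Fin r) ℂ)
    (T : Matrix (Fin r) (Fin r) ℂ) : gramDet R (Z * T) = gramDet R Z * ‖T.det‖ ^ 2 := by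
  have : (Z * T)ᴴ * R * (Z * T) = Tᴴ * (Zᴴ * R * Z) * T := by
    simp only [conjTranspose_mul, Matrix.mul_assoc]
  rw [gramDet, gramDet, this, det_mul, det_mul, det_conjTranspose, mul_comm (star _), mul_assoc,
    Complex.star_def, ← Complex.normSq_eq_conj_mul_self, Complex.re_mul_ofReal,
    Complex.normSq_eq_norm_sq]

lemma gaussWeight_mul {m r : ℕ} {R : Matrix (Fin m) (Fin m) ℂ}
    {Z : Matrix (Fin m) (Fin r) ℂ} {B : Matrix (Fin r) (Fin r) ℂ} (hB : Zᴴ * R * Z = Bᴴ * B)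
    (T : Matrix (Fin r) (Fin r) ℂ) : gaussWeight R (Z * T) = gaussWeight 1 (B * T) := by
  have : (Z * T)ᴴ * R * (Z * T) = (B * T)ᴴ * 1 * (B * T) := by
    calc (Z * T)ᴴ * R * (Z * T) = Tᴴ * (Zᴴ * R * Z) * T := by
          simp only [conjTranspose_mul, Matrix.mul_assoc]
      _ = _ := by
          rw [hB]
          simp only [conjTranspose_mul, Matrix.mul_assoc, Matrix.one_mul]
  rw [gaussWeight, gaussWeight, this]

lemma trace_conjTranspose_mul_self_re {m r : ℕ} (Z : Matrix (Fin m) (Fin r) ℂ) :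
    (Zᴴ * Z).trace.re = ∑ i, ∑ j, ‖Z i j‖ ^ 2 := by
  rw [Finset.sum_comm]
  simp only [Matrix.trace, Matrix.diag, Matrix.mul_apply, conjTranspose_apply, Complex.re_sum]
  refine Finset.sum_congr rfl fun j _ => Finset.sum_congr rfl fun i _ => ?_
  rw [Complex.star_def, ← Complex.normSq_eq_conj_mul_self, Complex.ofReal_re,
    Complex.normSq_eq_norm_sq]

/-- The Gaussian integral over matrices, a product of integrals over the entries. -/
lemma lintegral_exp_neg_mul_trace {m r : ℕ} {b : ℝ} (hb : 0 < b) :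
    ∫⁻ Z : Matrix (Fin m) (Fin r) ℂ, ENNReal.ofReal (Real.exp (-b * (Zᴴ * Z).trace.re)) =
      ENNReal.ofReal ((Real.pi / b) ^ (m * r)) := by
  have h1 : ∫ z : ℂ, Real.exp (-b * ‖z‖ ^ 2) = Real.pi / b := by
    have := Complex.integral_exp_neg_mul_rpow (p := 2) (by norm_num) hb
    have hG : Real.Gamma 2 = 1 := Real.Gamma_two
    norm_num [Real.rpow_neg_one, hG] at this
    simpa only [div_eq_mul_inv, neg_mul] using this
  have h2 : ∫ Z : Fin m → Fin r → ℂ, ∏ i, ∏ j, Real.exp (-b * ‖Z i j‖ ^ 2) =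
      (Real.pi / b) ^ (m * r) := by
    rw [integral_fintype_prod_volume_eq_prod
      (fun (_ : Fin m) (z : Fin r → ℂ) => ∏ j, Real.exp (-b * ‖z j‖ ^ 2))]
    simp_rw [integral_fintype_prod_volume_eq_prod
      (fun (_ : Fin r) (z : ℂ) => Real.exp (-b * ‖z‖ ^ 2)), h1]
    simp only [Finset.prod_const, Finset.card_univ, Fintype.card_fin, ← pow_mul, mul_comm]
  have hne : (Real.pi / b) ^ (m * r) ≠ 0 := by positivity
  have h3 : Integrable fun Z : Fin m → Fin r → ℂ => ∏ i, ∏ j, Real.exp (-b * ‖Z i j‖ ^ 2) :=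
    Integrable.of_integral_ne_zero (h2.trans_ne hne)
  rw [← h2, ofReal_integral_eq_lintegral_ofReal h3
    (Filter.Eventually.of_forall fun Z => by positivity)]
  refine lintegral_congr fun Z => ?_
  simp only [← Real.exp_sum, trace_conjTranspose_mul_self_re, Finset.mul_sum]

lemma lintegral_gaussWeight_one (m r : ℕ) :
    ∫⁻ Z : Matrix (Fin m) (Fin r) ℂ, gaussWeight 1 Z = ENNReal.ofReal (Real.pi ^ (m * r)) := by
  have := lintegral_exp_neg_mul_trace (m := m) (r := r) one_pos
  simpa [gaussWeight] using this

/-! ### Integration over the general linear group -/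

/-- The constant `∫ |det T|^{2m} exp (-tr (T̄' T)) dT / |det T|^{2r}`. -/
def gaussConst (m r : ℕ) : ℝ≥0∞ :=
  ∫⁻ T, ENNReal.ofReal (‖T.det‖ ^ (2 * m)) * gaussWeight 1 T ∂glMeasure r

/-- The constant `gaussConst` with `T⁻¹` in place of `T`. The two agree, see
`gaussConstInv_eq`. -/
def gaussConstInv (m r : ℕ) : ℝ≥0∞ :=
  ∫⁻ T, ENNReal.ofReal ((‖T.det‖ ^ (2 * m))⁻¹) * gaussWeight 1 T⁻¹ ∂glMeasure r

lemma gaussConst_ne_zero (m r : ℕ) : gaussConst m r ≠ 0 := by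
  intro h0
  have mdet : Measurable fun T : Matrix (Fin r) (Fin r) ℂ => T.det :=
    Continuous.measurable (by fun_prop)
  have mw := measurable_gaussWeight (r := r) (1 : Matrix (Fin r) (Fin r) ℂ)
  rw [gaussConst, lintegral_glMeasure, lintegral_eq_zero_iff (by fun_prop)] at h0
  obtain ⟨T, hT0, hT⟩ := (h0.and (ae_det_conjTranspose_mul_self_ne_zero le_rfl)).exists
  have hd : 0 < ‖T.det‖ := norm_pos_iff.mpr fun hd => hT (by rw [det_mul, hd, mul_zero])
  simp only [Pi.zero_apply, mul_eq_zero, ENNReal.ofReal_eq_zero, gaussWeight] at hT0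
  rcases hT0 with h1 | h1 | h1
  · exact absurd h1 (not_le.mpr (by positivity))
  · exact absurd h1 (not_le.mpr (by positivity))
  · exact absurd h1 (not_le.mpr (by positivity))

lemma norm_det_le {r : ℕ} (T : Matrix (Fin r) (Fin r) ℂ) :
    ‖T.det‖ ≤ r.factorial * √(Tᴴ * T).trace.re ^ r := by
  have := Matrix.det_le (A := T) (abv := NormedField.toAbsoluteValue ℂ)
    (x := √(Tᴴ * T).trace.re) (fun i j => by
      change ‖T i j‖ ≤ _
      refine Real.le_sqrt_of_sq_le ?_
      rw [trace_conjTranspose_mul_self_re]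
      calc ‖T i j‖ ^ 2 ≤ ∑ j, ‖T i j‖ ^ 2 :=
            Finset.single_le_sum (f := fun j => ‖T i j‖ ^ 2) (fun _ _ => by positivity)
              (Finset.mem_univ j)
        _ ≤ _ := Finset.single_le_sum (f := fun i => ∑ j, ‖T i j‖ ^ 2)
              (fun _ _ => by positivity) (Finset.mem_univ i))
  rw [Fintype.card_fin, nsmul_eq_mul] at this
  exact this

/-- The constant is finite because `m ≥ r` makes the integrand with respect to Lebesgue measure a
polynomial times a Gaussian. -/
lemma gaussConst_ne_top {m r : ℕ} (h : r ≤ m) : gaussConst m r ≠ ∞ := by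
  obtain ⟨k, rfl⟩ := Nat.exists_eq_add_of_le h
  -- `‖det T‖ ^ (2k)` is at most a multiple of `x ^ n` with `x = tr (T̄'T)`, and half of the
  -- Gaussian exponent absorbs this power: `x ^ n ≤ n! 2 ^ n exp (x / 2)`.
  set n := r * k
  let C : ℝ := (r.factorial : ℝ) ^ (2 * k) * (n.factorial * 2 ^ n)
  have hbound : ∀ T : Matrix (Fin r) (Fin r) ℂ,
      (‖T.det‖ ^ (2 * r))⁻¹ * (‖T.det‖ ^ (2 * (r + k)) * Real.exp (-(Tᴴ * 1 * T).trace.re)) ≤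
        C * Real.exp (-(1 / 2) * (Tᴴ * T).trace.re) := by
    intro T
    rw [Matrix.mul_one]
    set x := (Tᴴ * T).trace.re with hx
    have hx0 : 0 ≤ x := by
      rw [hx, trace_conjTranspose_mul_self_re]
      positivity
    have h1 : (‖T.det‖ ^ (2 * r))⁻¹ * ‖T.det‖ ^ (2 * (r + k)) ≤ ‖T.det‖ ^ (2 * k) := by
      rw [mul_add, pow_add, ← mul_assoc]
      exact mul_le_of_le_one_left (by positivity) (inv_mul_le_one)
    have h2 : ‖T.det‖ ^ (2 * k) ≤ (r.factorial : ℝ) ^ (2 * k) * x ^ n := by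
      calc ‖T.det‖ ^ (2 * k) ≤ (r.factorial * √x ^ r) ^ (2 * k) := by
            gcongr
            exact norm_det_le T
        _ = (r.factorial : ℝ) ^ (2 * k) * (√x ^ 2) ^ n := by
            rw [mul_pow, ← pow_mul, ← pow_mul]
            congr 2
            simp only [n]
            ring
        _ = _ := by rw [Real.sq_sqrt hx0]
    have h3 : x ^ n ≤ n.factorial * 2 ^ n * Real.exp (x / 2) := by
      have := Real.pow_div_factorial_le_exp (x := x / 2) (by positivity) n
      rw [div_pow, div_div, div_le_iff₀ (by positivity)] at this
      linarith
    calc _ = ((‖T.det‖ ^ (2 * r))⁻¹ * ‖T.det‖ ^ (2 * (r + k))) * Real.exp (-x) := by ring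
      _ ≤ ((r.factorial : ℝ) ^ (2 * k) * (n.factorial * 2 ^ n * Real.exp (x / 2))) *
          Real.exp (-x) := by
          refine mul_le_mul_of_nonneg_right ?_ (Real.exp_pos _).le
          exact h1.trans (h2.trans (mul_le_mul_of_nonneg_left h3 (by positivity)))
      _ = C * (Real.exp (x / 2) * Real.exp (-x)) := by simp only [C]; ring
      _ = _ := by
          rw [← Real.exp_add]
          congr 2
          ring
  refine ne_top_of_le_ne_top
    (b := ENNReal.ofReal C * ENNReal.ofReal ((Real.pi / (1 / 2)) ^ (r * r))) ?_ ?_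
  · exact ENNReal.mul_ne_top ENNReal.ofReal_ne_top ENNReal.ofReal_ne_top
  · rw [gaussConst, lintegral_glMeasure, ← lintegral_exp_neg_mul_trace (by norm_num),
      ← lintegral_const_mul' _ _ ENNReal.ofReal_ne_top]
    refine lintegral_mono fun T => ?_
    simp only [gaussWeight]
    rw [← ENNReal.ofReal_mul (by positivity), ← ENNReal.ofReal_mul (by positivity),
      ← ENNReal.ofReal_mul (by positivity)]
    exact ENNReal.ofReal_le_ofReal (hbound T)

/-- With `Z̄'RZ = B̄'B`, the substitution `T ↦ B⁻¹ T` reduces the integral to `gaussConst`. -/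
lemma lintegral_gaussWeight_mul {m r : ℕ} {R : Matrix (Fin m) (Fin m) ℂ}
    (hR : R.PosDef) {Z : Matrix (Fin m) (Fin r) ℂ} (hZ : (Zᴴ * Z).det ≠ 0) :
    ∫⁻ T, ENNReal.ofReal (‖T.det‖ ^ (2 * m)) * gaussWeight R (Z * T) ∂glMeasure r =
      gaussConst m r * ENNReal.ofReal ((gramDet R Z ^ m)⁻¹) := by
  obtain ⟨B, hB, hd⟩ := exists_gram_eq_conjTranspose_mul_self hR hZ
  have hn : ‖B.det‖ ^ (2 * m) ≠ 0 := pow_ne_zero _ (norm_ne_zero_iff.mpr hd)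
  rw [gaussConst, ← lintegral_glMeasure_mul_left hd (fun T => _ * gaussWeight 1 T),
    ← lintegral_mul_const' _ _ ENNReal.ofReal_ne_top]
  refine lintegral_congr fun T => ?_
  rw [gaussWeight_mul hB, gramDet_eq_norm_det_sq hB, mul_right_comm,
    ← ENNReal.ofReal_mul (by positivity), det_mul, norm_mul, mul_pow, ← pow_mul,
    mul_comm (‖B.det‖ ^ (2 * m)), mul_inv_cancel_right₀ hn]

/-- With `Z̄'RZ = B̄'B`, the substitution `T ↦ T B` reduces the integral to `gaussConstInv`. -/
lemma lintegral_gaussWeight_mul_inv {m r : ℕ} {R : Matrix (Fin m) (Fin m) ℂ}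
    (hR : R.PosDef) {Z : Matrix (Fin m) (Fin r) ℂ} (hZ : (Zᴴ * Z).det ≠ 0) :
    ∫⁻ T, ENNReal.ofReal ((‖T.det‖ ^ (2 * m))⁻¹) * gaussWeight R (Z * T⁻¹) ∂glMeasure r =
      gaussConstInv m r * ENNReal.ofReal ((gramDet R Z ^ m)⁻¹) := by
  obtain ⟨B, hB, hd⟩ := exists_gram_eq_conjTranspose_mul_self hR hZ
  have hn : ‖B.det‖ ^ (2 * m) ≠ 0 := pow_ne_zero _ (norm_ne_zero_iff.mpr hd)
  have hd' : (B⁻¹).det ≠ 0 := by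
    rw [det_nonsing_inv, Ring.inverse_eq_inv']
    exact inv_ne_zero hd
  rw [gaussConstInv, ← lintegral_glMeasure_mul_right hd' (fun T => _ * gaussWeight 1 T⁻¹),
    ← lintegral_mul_const' _ _ ENNReal.ofReal_ne_top]
  refine lintegral_congr fun T => ?_
  rw [gaussWeight_mul hB, gramDet_eq_norm_det_sq hB, mul_right_comm,
    ← ENNReal.ofReal_mul (by positivity), Matrix.mul_inv_rev,
    nonsing_inv_nonsing_inv _ hd.isUnit, det_mul, det_nonsing_inv, Ring.inverse_eq_inv', norm_mul,
    norm_inv, mul_pow, ← pow_mul, inv_pow, mul_inv, inv_inv, mul_inv_cancel_right₀ hn]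

/-- The double integral of
`φ(Z) |Z̄'Z|^m exp (-tr (Z̄'RZ)) |det T|^{2m} exp (-tr (T̄'Z̄'ZT))`, for `φ` invariant under the
right action of `GL_r(ℂ)`, evaluated once over `T` first and once after the substitution
`Z ↦ Z T⁻¹`. -/
lemma gaussConst_mul_lintegral {m r : ℕ} (h : r ≤ m) {R : Matrix (Fin m) (Fin m) ℂ}
    (hR : R.PosDef) {φ : Matrix (Fin m) (Fin r) ℂ → ℝ≥0∞} (hφ : Measurable φ)
    (hinv : ∀ (Z : Matrix (Fin m) (Fin r) ℂ) (T : Matrix (Fin r) (Fin r) ℂ),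
      (Zᴴ * Z).det ≠ 0 → T.det ≠ 0 → φ (Z * T) = φ Z) :
    gaussConst m r * ∫⁻ Z, φ Z * gaussWeight R Z =
      gaussConstInv m r * ∫⁻ Z, φ Z *
        (ENNReal.ofReal ((gramDet R Z ^ m)⁻¹ * gramDet 1 Z ^ m) * gaussWeight 1 Z) := by
  have hrank := ae_det_conjTranspose_mul_self_ne_zero h
  have mdet : Measurable fun T : Matrix (Fin r) (Fin r) ℂ => T.det :=
    Continuous.measurable (by fun_prop)
  have mg := measurable_gramDet (r := r) (1 : Matrix (Fin m) (Fin m) ℂ)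
  have mw1 := measurable_gaussWeight (r := r) (1 : Matrix (Fin m) (Fin m) ℂ)
  have mwR := measurable_gaussWeight (r := r) R
  have mmul : Measurable fun p : Matrix (Fin m) (Fin r) ℂ × Matrix (Fin r) (Fin r) ℂ =>
      p.1 * p.2 := Continuous.measurable (by fun_prop)
  have mmulinv : Measurable fun p : Matrix (Fin m) (Fin r) ℂ × Matrix (Fin r) (Fin r) ℂ =>
      p.1 * p.2⁻¹ :=
    mmul.comp (measurable_fst.prodMk ((measurable_matrix_inv r).comp measurable_snd))
  -- `K` is the integrand of the double integral, `K'` the integrand after `Z ↦ Z T⁻¹`,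
  -- including the Jacobian.
  let K : Matrix (Fin m) (Fin r) ℂ → Matrix (Fin r) (Fin r) ℂ → ℝ≥0∞ := fun Z T =>
    φ Z * ENNReal.ofReal (gramDet 1 Z ^ m) * gaussWeight R Z *
      (ENNReal.ofReal (‖T.det‖ ^ (2 * m)) * gaussWeight 1 (Z * T))
  let K' : Matrix (Fin m) (Fin r) ℂ → Matrix (Fin r) (Fin r) ℂ → ℝ≥0∞ := fun Z T =>
    φ Z * ENNReal.ofReal (gramDet 1 Z ^ m) * gaussWeight 1 Z *
      (ENNReal.ofReal ((‖T.det‖ ^ (2 * m))⁻¹) * gaussWeight R (Z * T⁻¹))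
  have mK : Measurable (Function.uncurry K) := by
    have a := mw1.comp mmul
    simp only [K, Function.uncurry_def]
    fun_prop
  have mK' : Measurable (Function.uncurry K') := by
    have a := mwR.comp mmulinv
    simp only [K', Function.uncurry_def]
    fun_prop
  have hone : (1 : Matrix (Fin m) (Fin m) ℂ).PosDef := .one
  have e1 : ∫⁻ Z, ∫⁻ T, K Z T ∂glMeasure r = gaussConst m r * ∫⁻ Z, φ Z * gaussWeight R Z := by
    rw [← lintegral_const_mul _ (by fun_prop)]
    refine lintegral_congr_ae ?_
    filter_upwards [hrank] with Z hZ
    have hpos := gramDet_pos hone hZ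
    have mT : Measurable fun T : Matrix (Fin r) (Fin r) ℂ =>
        ENNReal.ofReal (‖T.det‖ ^ (2 * m)) * gaussWeight 1 (Z * T) := by
      have a := mw1.comp (mmul.comp (measurable_const (a := Z) |>.prodMk measurable_id))
      have a' : Measurable fun T : Matrix (Fin r) (Fin r) ℂ => gaussWeight 1 (Z * T) := a
      fun_prop
    simp only [K]
    rw [lintegral_const_mul _ mT, lintegral_gaussWeight_mul hone hZ]
    calc _ = gaussConst m r * (φ Z * gaussWeight R Z) *
          (ENNReal.ofReal (gramDet 1 Z ^ m) * ENNReal.ofReal ((gramDet 1 Z ^ m)⁻¹)) := by ring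
      _ = _ := by
          rw [← ENNReal.ofReal_mul (by positivity), mul_inv_cancel₀ (by positivity),
            ENNReal.ofReal_one, mul_one]
  have e2 : ∫⁻ Z, ∫⁻ T, K' Z T ∂glMeasure r = gaussConstInv m r * ∫⁻ Z, φ Z *
        (ENNReal.ofReal ((gramDet R Z ^ m)⁻¹ * gramDet 1 Z ^ m) * gaussWeight 1 Z) := by
    have mgR := measurable_gramDet (r := r) R
    rw [← lintegral_const_mul _ (by fun_prop)]
    refine lintegral_congr_ae ?_
    filter_upwards [hrank] with Z hZ
    have hposR := gramDet_pos hR hZ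
    have mT : Measurable fun T : Matrix (Fin r) (Fin r) ℂ =>
        ENNReal.ofReal ((‖T.det‖ ^ (2 * m))⁻¹) * gaussWeight R (Z * T⁻¹) := by
      have a := mwR.comp (mmulinv.comp (measurable_const (a := Z) |>.prodMk measurable_id))
      have a' : Measurable fun T : Matrix (Fin r) (Fin r) ℂ => gaussWeight R (Z * T⁻¹) := a
      fun_prop
    simp only [K']
    rw [lintegral_const_mul _ mT, lintegral_gaussWeight_mul_inv hR hZ,
      ENNReal.ofReal_mul (by positivity)]
    ring
  rw [← e1, ← e2, lintegral_lintegral_swap mK.aemeasurable,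
    lintegral_lintegral_swap mK'.aemeasurable]
  refine lintegral_congr_ae ?_
  filter_upwards [ae_glMeasure_det_ne_zero r] with T hT
  have hTi : (T⁻¹).det ≠ 0 := by
    rw [det_nonsing_inv, Ring.inverse_eq_inv']
    exact inv_ne_zero hT
  have hn : 0 < ‖T.det‖ := norm_pos_iff.mpr hT
  rw [← lintegral_comp_mul_right hTi (fun Z => K Z T),
    ← lintegral_const_mul' _ _ ENNReal.ofReal_ne_top]
  refine lintegral_congr_ae ?_
  filter_upwards [hrank] with Z hZ
  have hpos := gramDet_pos hone hZ
  have hZT : Z * T⁻¹ * T = Z := by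
    rw [Matrix.mul_assoc, nonsing_inv_mul _ hT.isUnit, Matrix.mul_one]
  simp only [K, K', hZT, hinv Z _ hZ hTi, gramDet_mul]
  have hJ : ENNReal.ofReal (‖(T⁻¹).det‖ ^ (2 * m)) *
      ENNReal.ofReal ((gramDet 1 Z * ‖(T⁻¹).det‖ ^ 2) ^ m) * ENNReal.ofReal (‖T.det‖ ^ (2 * m)) =
      ENNReal.ofReal (gramDet 1 Z ^ m) * ENNReal.ofReal ((‖T.det‖ ^ (2 * m))⁻¹) := by
    rw [← ENNReal.ofReal_mul (by positivity), ← ENNReal.ofReal_mul (by positivity),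
      ← ENNReal.ofReal_mul (by positivity), det_nonsing_inv, Ring.inverse_eq_inv', norm_inv]
    congr 1
    rw [mul_pow, ← pow_mul, inv_pow]
    field_simp
  calc _ = φ Z * gaussWeight R (Z * T⁻¹) * gaussWeight 1 Z *
        (ENNReal.ofReal (‖(T⁻¹).det‖ ^ (2 * m)) *
      ENNReal.ofReal ((gramDet 1 Z * ‖(T⁻¹).det‖ ^ 2) ^ m) *
        ENNReal.ofReal (‖T.det‖ ^ (2 * m))) := by ring
    _ = _ := by rw [hJ]; ring

/-- The double integral for `R = I` and `φ = 1` compares the two constants. -/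
lemma gaussConstInv_eq {m r : ℕ} (h : r ≤ m) : gaussConstInv m r = gaussConst m r := by
  have h1 := gaussConst_mul_lintegral h (R := (1 : Matrix (Fin m) (Fin m) ℂ)) .one
    (φ := fun _ : Matrix (Fin m) (Fin r) ℂ => 1) measurable_const (fun _ _ _ _ => rfl)
  have h2 : ∫⁻ Z : Matrix (Fin m) (Fin r) ℂ, 1 *
      (ENNReal.ofReal ((gramDet 1 Z ^ m)⁻¹ * gramDet 1 Z ^ m) * gaussWeight 1 Z) =
      ∫⁻ Z : Matrix (Fin m) (Fin r) ℂ, gaussWeight 1 Z := by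
    refine lintegral_congr_ae ?_
    filter_upwards [ae_det_conjTranspose_mul_self_ne_zero h] with Z hZ
    have hpos := gramDet_pos (.one : (1 : Matrix (Fin m) (Fin m) ℂ).PosDef) hZ
    rw [inv_mul_cancel₀ (by positivity), ENNReal.ofReal_one, one_mul, one_mul]
  rw [h2] at h1
  simp only [one_mul, lintegral_gaussWeight_one] at h1
  have hpi : 0 < Real.pi ^ (m * r) := by positivity
  exact ((ENNReal.mul_left_inj (ENNReal.ofReal_pos.mpr hpi).ne' ENNReal.ofReal_ne_top).mp h1).symm

/-- Functions that depend only on the column space have the same integral against the Gaussian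
weight of `R` and against the standard Gaussian weight times `|Z̄'RZ|^{-m} |Z̄'Z|^m`. -/
lemma lintegral_mul_gaussWeight_of_invariant {m r : ℕ} (h : r ≤ m) {R : Matrix (Fin m) (Fin m) ℂ}
    (hR : R.PosDef) {φ : Matrix (Fin m) (Fin r) ℂ → ℝ≥0∞} (hφ : Measurable φ)
    (hinv : ∀ (Z : Matrix (Fin m) (Fin r) ℂ) (T : Matrix (Fin r) (Fin r) ℂ),
      (Zᴴ * Z).det ≠ 0 → T.det ≠ 0 → φ (Z * T) = φ Z) :
    ∫⁻ Z, φ Z * gaussWeight R Z =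
      ∫⁻ Z, φ Z *
        (ENNReal.ofReal ((gramDet R Z ^ m)⁻¹ * gramDet 1 Z ^ m) * gaussWeight 1 Z) := by
  have h1 := gaussConst_mul_lintegral h hR hφ hinv
  rw [gaussConstInv_eq h] at h1
  exact (ENNReal.mul_right_inj (gaussConst_ne_zero m r) (gaussConst_ne_top h)).mp h1

/-! ### The orientation -/

lemma sqrt_gram_mul_self {m r : ℕ} (Z : Matrix (Fin m) (Fin r) ℂ) :
    CFC.sqrt (Zᴴ * Z) * CFC.sqrt (Zᴴ * Z) = Zᴴ * Z :=
  CFC.sqrt_mul_sqrt_self _ (posSemidef_conjTranspose_mul_self Z).nonneg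

lemma conjTranspose_sqrt_gram {m r : ℕ} (Z : Matrix (Fin m) (Fin r) ℂ) :
    (CFC.sqrt (Zᴴ * Z))ᴴ = CFC.sqrt (Zᴴ * Z) :=
  (CFC.sqrt_nonneg (Zᴴ * Z)).posSemidef.isHermitian

lemma det_sqrt_gram_ne_zero {m r : ℕ} {Z : Matrix (Fin m) (Fin r) ℂ} (hZ : (Zᴴ * Z).det ≠ 0) :
    (CFC.sqrt (Zᴴ * Z)).det ≠ 0 := by
  intro h0
  rw [← sqrt_gram_mul_self, det_mul, h0, mul_zero] at hZ
  exact hZ rfl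

lemma orientation_mem_stiefel {m r : ℕ} {Z : Matrix (Fin m) (Fin r) ℂ} (hZ : (Zᴴ * Z).det ≠ 0) :
    orientation Z ∈ stiefel m r := by
  have hu := (det_sqrt_gram_ne_zero hZ).isUnit
  change (orientation Z)ᴴ * orientation Z = 1
  simp only [orientation]
  rw [conjTranspose_mul, conjTranspose_nonsing_inv, conjTranspose_sqrt_gram, Matrix.mul_assoc,
    ← Matrix.mul_assoc Zᴴ]
  generalize hS : CFC.sqrt (Zᴴ * Z) = S at *
  rw [← sqrt_gram_mul_self, hS, Matrix.mul_assoc S S, mul_nonsing_inv _ hu, Matrix.mul_one,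
    nonsing_inv_mul _ hu]

lemma orientation_unitary_mul {m r : ℕ} {U : Matrix (Fin m) (Fin m) ℂ}
    (hU : U ∈ unitaryGroup (Fin m) ℂ) (Z : Matrix (Fin m) (Fin r) ℂ) :
    orientation (U * Z) = U * orientation Z := by
  have hU' : Uᴴ * U = 1 := mem_unitaryGroup_iff'.mp hU
  have : (U * Z)ᴴ * (U * Z) = Zᴴ * Z := by
    rw [conjTranspose_mul, Matrix.mul_assoc, ← Matrix.mul_assoc Uᴴ, hU', Matrix.one_mul]
  rw [orientation, orientation, this, Matrix.mul_assoc]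

lemma orientation_mul_unitary {m r : ℕ} (Z : Matrix (Fin m) (Fin r) ℂ)
    {V : Matrix (Fin r) (Fin r) ℂ} (hV : V ∈ unitaryGroup (Fin r) ℂ) :
    orientation (Z * V) = orientation Z * V := by
  have hV' : Vᴴ * V = 1 := mem_unitaryGroup_iff'.mp hV
  have hV2 : V * Vᴴ = 1 := mem_unitaryGroup_iff.mp hV
  have hinv : V⁻¹ = Vᴴ := inv_eq_left_inv hV'
  have hinv' : (Vᴴ)⁻¹ = V := inv_eq_left_inv hV2
  have hs : CFC.sqrt ((Z * V)ᴴ * (Z * V)) = Vᴴ * CFC.sqrt (Zᴴ * Z) * V := by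
    refine CFC.sqrt_unique ?_
      ((CFC.sqrt_nonneg (Zᴴ * Z)).posSemidef.conjTranspose_mul_mul_same V).nonneg
    calc Vᴴ * CFC.sqrt (Zᴴ * Z) * V * (Vᴴ * CFC.sqrt (Zᴴ * Z) * V)
        = Vᴴ * CFC.sqrt (Zᴴ * Z) * (V * Vᴴ) * CFC.sqrt (Zᴴ * Z) * V := by
          simp only [Matrix.mul_assoc]
      _ = Vᴴ * (CFC.sqrt (Zᴴ * Z) * CFC.sqrt (Zᴴ * Z)) * V := by
          rw [hV2, Matrix.mul_one]
          simp only [Matrix.mul_assoc]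
      _ = _ := by
          rw [sqrt_gram_mul_self, conjTranspose_mul]
          simp only [Matrix.mul_assoc]
  rw [orientation, orientation, hs, Matrix.mul_inv_rev, Matrix.mul_inv_rev, hinv, hinv']
  calc Z * V * (Vᴴ * ((CFC.sqrt (Zᴴ * Z))⁻¹ * V))
      = Z * (V * Vᴴ) * ((CFC.sqrt (Zᴴ * Z))⁻¹ * V) := by simp only [Matrix.mul_assoc]
    _ = _ := by rw [hV2, Matrix.mul_one, Matrix.mul_assoc]

/-- `Z` and `Z T` have the same column space, so their orientations differ by a unitary matrix. -/
lemma exists_orientation_mul {m r : ℕ} {Z : Matrix (Fin m) (Fin r) ℂ} (hZ : (Zᴴ * Z).det ≠ 0)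
    {T : Matrix (Fin r) (Fin r) ℂ} (hT : T.det ≠ 0) :
    ∃ V : unitaryGroup (Fin r) ℂ, orientation (Z * T) = orientation Z * V.1 := by
  have hZT : ((Z * T)ᴴ * (Z * T)).det ≠ 0 := by
    have : (Z * T)ᴴ * (Z * T) = Tᴴ * (Zᴴ * Z) * T := by
      simp only [conjTranspose_mul, Matrix.mul_assoc]
    rw [this, det_mul, det_mul, det_conjTranspose]
    exact mul_ne_zero (mul_ne_zero (star_ne_zero.mpr hT) hZ) hT
  have hu := (det_sqrt_gram_ne_zero hZ).isUnit
  have h1 : (orientation Z)ᴴ * orientation Z = 1 := orientation_mem_stiefel hZ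
  have h2 : (orientation (Z * T))ᴴ * orientation (Z * T) = 1 := orientation_mem_stiefel hZT
  have h3 : orientation (Z * T) =
      orientation Z * (CFC.sqrt (Zᴴ * Z) * T * (CFC.sqrt ((Z * T)ᴴ * (Z * T)))⁻¹) := by
    simp only [orientation, Matrix.mul_assoc]
    rw [nonsing_inv_mul_cancel_left _ _ hu]
  set V := CFC.sqrt (Zᴴ * Z) * T * (CFC.sqrt ((Z * T)ᴴ * (Z * T)))⁻¹
  refine ⟨⟨V, mem_unitaryGroup_iff'.mpr ?_⟩, h3⟩
  rw [h3, conjTranspose_mul, Matrix.mul_assoc, ← Matrix.mul_assoc _ (orientation Z), h1,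
    Matrix.one_mul] at h2
  exact h2

lemma gramDet_orientation {m r : ℕ} (R : Matrix (Fin m) (Fin m) ℂ)
    (Z : Matrix (Fin m) (Fin r) ℂ) :
    gramDet R (orientation Z) = gramDet R Z * (gramDet 1 Z)⁻¹ := by
  have h1 : gramDet 1 Z = ‖(CFC.sqrt (Zᴴ * Z)).det‖ ^ 2 :=
    gramDet_eq_norm_det_sq (by
      rw [conjTranspose_sqrt_gram, sqrt_gram_mul_self, Matrix.mul_one])
  rw [orientation, gramDet_mul, det_nonsing_inv, Ring.inverse_eq_inv', norm_inv, inv_pow, h1]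

lemma isClosed_nonneg_matrix (r : ℕ) : IsClosed {A : Matrix (Fin r) (Fin r) ℂ | 0 ≤ A} := by
  have : {A : Matrix (Fin r) (Fin r) ℂ | 0 ≤ A} =
      {A | Aᴴ = A} ∩ ⋂ x : Fin r → ℂ, {A | 0 ≤ star x ⬝ᵥ (A *ᵥ x)} := by
    ext A
    simp [Matrix.nonneg_iff_posSemidef, posSemidef_iff_dotProduct_mulVec, Matrix.IsHermitian]
  rw [this]
  refine (isClosed_eq (by fun_prop) continuous_id).inter (isClosed_iInter fun x => ?_)
  exact isClosed_le continuous_const (by fun_prop)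

/-- The positive semidefinite square root is the inverse of squaring, a continuous injection on
the closed cone of positive semidefinite matrices. Hence it is Borel measurable, by the
Lusin-Souslin theorem. -/
lemma measurable_orientation (m r : ℕ) :
    Measurable (orientation : Matrix (Fin m) (Fin r) ℂ → Matrix (Fin m) (Fin r) ℂ) := by
  have hemb : MeasurableEmbedding
      ({A : Matrix (Fin r) (Fin r) ℂ | 0 ≤ A}.domRestrict fun A => A * A) := by
    refine ContinuousOn.measurableEmbedding (isClosed_nonneg_matrix r).measurableSet
      (Continuous.continuousOn (by fun_prop)) fun A hA B hB hAB => ?_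
    rw [← CFC.sqrt_mul_self A hA, ← CFC.sqrt_mul_self B hB]
    exact congrArg CFC.sqrt hAB
  -- A measurable left inverse of squaring, extended arbitrarily off the cone.
  obtain ⟨g, hg, hgA⟩ := hemb.exists_measurable_extend measurable_subtype_coe fun _ => ⟨1⟩
  have hsqrt : ∀ Z : Matrix (Fin m) (Fin r) ℂ, CFC.sqrt (Zᴴ * Z) = g (Zᴴ * Z) := fun Z => by
    have := congrFun hgA ⟨CFC.sqrt (Zᴴ * Z),
      show 0 ≤ CFC.sqrt (Zᴴ * Z) from CFC.sqrt_nonneg _⟩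
    conv_rhs => rw [← sqrt_gram_mul_self Z]
    exact this.symm
  have hgram : Measurable fun Z : Matrix (Fin m) (Fin r) ℂ => Zᴴ * Z :=
    Continuous.measurable (by fun_prop)
  have hmul : Measurable fun p : Matrix (Fin m) (Fin r) ℂ × Matrix (Fin r) (Fin r) ℂ =>
      p.1 * p.2 := Continuous.measurable (by fun_prop)
  unfold orientation
  simp_rw [hsqrt]
  exact hmul.comp (measurable_id.prodMk ((measurable_matrix_inv r).comp (hg.comp hgram)))

/-! ### Averaging over the right action of the unitary group -/

lemma norm_det_unitary {r : ℕ} (U : unitaryGroup (Fin r) ℂ) : ‖U.1.det‖ = 1 := by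
  have : U.1.det ∈ unitary ℂ := det_of_mem_unitary U.2
  exact CStarRing.norm_of_mem_unitary this

lemma gaussWeight_mul_unitary {m r : ℕ} (R : Matrix (Fin m) (Fin m) ℂ)
    (Z : Matrix (Fin m) (Fin r) ℂ) (U : unitaryGroup (Fin r) ℂ) :
    gaussWeight R (Z * U.1) = gaussWeight R Z := by
  have hU : U.1 * U.1ᴴ = 1 := mem_unitaryGroup_iff.mp U.2
  have : ((Z * U.1)ᴴ * R * (Z * U.1)).trace = (Zᴴ * R * Z).trace := by
    calc _ = (U.1ᴴ * (Zᴴ * R * Z * U.1)).trace := by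
          simp only [conjTranspose_mul, Matrix.mul_assoc]
      _ = _ := by rw [Matrix.trace_mul_comm, Matrix.mul_assoc, hU, Matrix.mul_one]
  rw [gaussWeight, gaussWeight, this]

/-- Integration against a weight invariant under the right action of `U(r)` does not see the
difference between `ψ(H_Z)` and its average over that action. -/
lemma lintegral_average_orientation {m r : ℕ} {ψ w : Matrix (Fin m) (Fin r) ℂ → ℝ≥0∞}
    (hψ : Measurable ψ) (hw : Measurable w)
    (hinv : ∀ Z (U : unitaryGroup (Fin r) ℂ), w (Z * U.1) = w Z) :
    ∫⁻ Z, (∫⁻ U, ψ (orientation Z * U.1) ∂unitaryHaar r) * w Z =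
      ∫⁻ Z, ψ (orientation Z) * w Z := by
  have hmul : Measurable fun p : Matrix (Fin m) (Fin r) ℂ × unitaryGroup (Fin r) ℂ =>
      p.1 * p.2.1 := Continuous.measurable (by fun_prop)
  have hm : Measurable fun p : Matrix (Fin m) (Fin r) ℂ × unitaryGroup (Fin r) ℂ =>
      ψ (orientation p.1 * p.2.1) := hψ.comp (hmul.comp
        (((measurable_orientation m r).comp measurable_fst).prodMk measurable_snd))
  have h1 : ∀ Z : Matrix (Fin m) (Fin r) ℂ,
      (∫⁻ U, ψ (orientation Z * U.1) ∂unitaryHaar r) * w Z =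
        ∫⁻ U, ψ (orientation Z * U.1) * w Z ∂unitaryHaar r := fun Z =>
    (lintegral_mul_const _ (hm.comp measurable_prodMk_left)).symm
  simp_rw [h1]
  rw [lintegral_lintegral_swap (by
    exact (hm.mul (hw.comp measurable_fst)).aemeasurable)]
  have h2 : ∀ U : unitaryGroup (Fin r) ℂ, ∫⁻ Z, ψ (orientation Z * U.1) * w Z =
      ∫⁻ Z, ψ (orientation Z) * w Z := by
    intro U
    have hd : U.1.det ≠ 0 := by
      rw [← norm_ne_zero_iff, norm_det_unitary]
      exact one_ne_zero
    rw [← lintegral_comp_mul_right hd (fun Z => ψ (orientation Z) * w Z), norm_det_unitary, one_pow,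
      ENNReal.ofReal_one, one_mul]
    exact lintegral_congr fun Z => by rw [orientation_mul_unitary Z U.2, hinv]
  simp [h2]

/-- The identity of `lintegral_mul_gaussWeight_of_invariant` for arbitrary functions of the
orientation: their average over the right action of `U(r)` depends only on the column space. -/
lemma lintegral_orientation_mul_gaussWeight {m r : ℕ} (h : r ≤ m) {R : Matrix (Fin m) (Fin m) ℂ}
    (hR : R.PosDef) {ψ : Matrix (Fin m) (Fin r) ℂ → ℝ≥0∞} (hψ : Measurable ψ) :
    ∫⁻ Z, ψ (orientation Z) * gaussWeight R Z =
      ∫⁻ Z, ψ (orientation Z) *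
        (ENNReal.ofReal ((gramDet R Z ^ m)⁻¹ * gramDet 1 Z ^ m) * gaussWeight 1 Z) := by
  have mg1 := measurable_gramDet (r := r) (1 : Matrix (Fin m) (Fin m) ℂ)
  have mgR := measurable_gramDet (r := r) R
  have mw1 := measurable_gaussWeight (r := r) (1 : Matrix (Fin m) (Fin m) ℂ)
  have hmul : Measurable fun p : Matrix (Fin m) (Fin r) ℂ × unitaryGroup (Fin r) ℂ =>
      p.1 * p.2.1 := Continuous.measurable (by fun_prop)
  have hm : Measurable fun p : Matrix (Fin m) (Fin r) ℂ × unitaryGroup (Fin r) ℂ =>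
      ψ (orientation p.1 * p.2.1) := hψ.comp (hmul.comp
        (((measurable_orientation m r).comp measurable_fst).prodMk measurable_snd))
  rw [← lintegral_average_orientation hψ (measurable_gaussWeight R)
      (fun Z U => gaussWeight_mul_unitary R Z U),
    ← lintegral_average_orientation hψ (by fun_prop)
      (fun Z U => by
        rw [gaussWeight_mul_unitary, gramDet_mul, gramDet_mul, norm_det_unitary, one_pow, mul_one,
          mul_one])]
  refine lintegral_mul_gaussWeight_of_invariant h hR
    (φ := fun Z => ∫⁻ U, ψ (orientation Z * U.1) ∂unitaryHaar r) hm.lintegral_prod_right'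
    fun Z T hZ hT => ?_
  obtain ⟨V, hV⟩ := exists_orientation_mul hZ hT
  simp only [hV]
  rw [← lintegral_mul_left_eq_self (fun U : unitaryGroup (Fin r) ℂ => ψ (orientation Z * U.1)) V]
  exact lintegral_congr fun U => by rw [Matrix.mul_assoc]; rfl

/-! ### The orientation of a standard normal matrix -/

/-- The orientation as a point of the Stiefel manifold, with an arbitrary value on the null set of
matrices without full column rank. -/
def stiefelOrientation {m r : ℕ} (h : r ≤ m) (Z : Matrix (Fin m) (Fin r) ℂ) : stiefel m r :=
  open scoped Classical in
  if hZ : orientation Z ∈ stiefel m r then ⟨orientation Z, hZ⟩ else firstColumns h 1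

lemma stiefelOrientation_eq {m r : ℕ} (h : r ≤ m) {Z : Matrix (Fin m) (Fin r) ℂ}
    (hZ : (Zᴴ * Z).det ≠ 0) : (stiefelOrientation h Z).1 = orientation Z := by
  rw [stiefelOrientation, dif_pos (orientation_mem_stiefel hZ)]

lemma measurable_stiefelOrientation {m r : ℕ} (h : r ≤ m) :
    Measurable (stiefelOrientation h : Matrix (Fin m) (Fin r) ℂ → stiefel m r) := by
  have hs : MeasurableSet (stiefel m r) :=
    (isClosed_eq (f := fun X : Matrix (Fin m) (Fin r) ℂ => Xᴴ * X) (by fun_prop)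
      continuous_const).measurableSet
  have hs' := measurable_orientation m r hs
  classical
  have hf : Measurable fun X : orientation ⁻¹' stiefel m r =>
      (⟨orientation X.1, X.2⟩ : stiefel m r) :=
    ((measurable_orientation m r).comp measurable_subtype_coe).subtype_mk
  have hg : Measurable fun _ : ((orientation ⁻¹' stiefel m r)ᶜ :
      Set (Matrix (Fin m) (Fin r) ℂ)) => firstColumns h 1 := measurable_const
  exact Measurable.dite hf hg hs'

/-- The standard normal law is invariant under `Z ↦ U Z`, hence so is the law of its orientation,
which must then be the normalized invariant measure. -/
lemma lintegral_orientation_mul_gaussWeight_one {m r : ℕ} (h : r ≤ m)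
    {g : Matrix (Fin m) (Fin r) ℂ → ℝ≥0∞} (hg : Measurable g) :
    ∫⁻ Z, g (orientation Z) * gaussWeight 1 Z =
      ENNReal.ofReal (Real.pi ^ (m * r)) * ∫⁻ X, g X.1 ∂stiefelMeasure h := by
  have mw := measurable_gaussWeight (r := r) (1 : Matrix (Fin m) (Fin m) ℂ)
  have mo := measurable_stiefelOrientation (r := r) h
  have hrank := ae_det_conjTranspose_mul_self_ne_zero h
  have hpi : ENNReal.ofReal (Real.pi ^ (m * r)) ≠ 0 :=
    (ENNReal.ofReal_pos.mpr (by positivity)).ne'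
  -- The standard normal law.
  let γ : Measure (Matrix (Fin m) (Fin r) ℂ) :=
    (ENNReal.ofReal (Real.pi ^ (m * r)))⁻¹ • volume.withDensity (gaussWeight 1)
  have hγ : IsProbabilityMeasure γ := ⟨by
    simp only [γ, Measure.smul_apply, withDensity_apply _ MeasurableSet.univ,
      Measure.restrict_univ, lintegral_gaussWeight_one, smul_eq_mul]
    exact ENNReal.inv_mul_cancel hpi ENNReal.ofReal_ne_top⟩
  have hac : γ ≪ volume := (withDensity_absolutelyContinuous _ _).smul_left _
  have hγU : ∀ U : unitaryGroup (Fin m) ℂ, γ.map (U.1 * ·) = γ := by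
    intro U
    have mU : Measurable fun Z : Matrix (Fin m) (Fin r) ℂ => U.1 * Z :=
      Continuous.measurable (by fun_prop)
    have hU : U.1ᴴ * U.1 = 1 := mem_unitaryGroup_iff'.mp U.2
    have hd : U.1.det ≠ 0 := by
      rw [← norm_ne_zero_iff, norm_det_unitary]
      exact one_ne_zero
    simp only [γ, Measure.map_smul]
    congr 1
    ext s hs
    rw [Measure.map_apply mU hs, withDensity_apply _ hs, withDensity_apply _ (mU hs),
      ← lintegral_indicator hs, ← lintegral_indicator (mU hs),
      ← lintegral_comp_mul_left hd (s.indicator (gaussWeight 1)), norm_det_unitary, one_pow,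
      ENNReal.ofReal_one, one_mul]
    refine lintegral_congr fun Z => ?_
    have hw : gaussWeight 1 (U.1 * Z) = gaussWeight 1 Z := by
      have : (U.1 * Z)ᴴ * (1 : Matrix (Fin m) (Fin m) ℂ) * (U.1 * Z) =
          Zᴴ * (1 : Matrix (Fin m) (Fin m) ℂ) * Z := by
        rw [Matrix.mul_one, Matrix.mul_one, conjTranspose_mul, Matrix.mul_assoc,
          ← Matrix.mul_assoc U.1ᴴ, hU, Matrix.one_mul]
      rw [gaussWeight, gaussWeight, this]
    by_cases hZ : U.1 * Z ∈ s <;> simp [Set.indicator, hZ, hw]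
  have hν : IsProbabilityMeasure (γ.map (stiefelOrientation h)) :=
    Measure.isProbabilityMeasure_map mo.aemeasurable
  have heq : γ.map (stiefelOrientation h) = stiefelMeasure h := by
    refine eq_stiefelMeasure h _ fun U => ?_
    have mU : Measurable fun Z : Matrix (Fin m) (Fin r) ℂ => U.1 * Z :=
      Continuous.measurable (by fun_prop)
    conv_rhs => rw [← hγU U, Measure.map_map mo mU]
    rw [Measure.map_map (measurable_rotate U) mo]
    refine Measure.map_congr (hac.ae_le ?_)
    filter_upwards [hrank] with Z hZ
    have hUZ : ((U.1 * Z)ᴴ * (U.1 * Z)).det ≠ 0 := by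
      rwa [conjTranspose_mul, Matrix.mul_assoc, ← Matrix.mul_assoc U.1ᴴ,
        show U.1ᴴ * U.1 = 1 from mem_unitaryGroup_iff'.mp U.2, Matrix.one_mul]
    refine Subtype.ext ?_
    simp only [Function.comp_apply]
    rw [stiefelOrientation_eq h hUZ, orientation_unitary_mul U.2, ← stiefelOrientation_eq h hZ]
    rfl
  have hg' : Measurable fun X : stiefel m r => g X.1 := hg.comp measurable_subtype_coe
  rw [← heq, lintegral_map hg' mo, lintegral_smul_measure,
    smul_eq_mul, ← mul_assoc, ENNReal.mul_inv_cancel hpi ENNReal.ofReal_ne_top, one_mul,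
    lintegral_withDensity_eq_lintegral_mul _ mw
      (show Measurable fun Z => g (stiefelOrientation h Z).1 from hg'.comp mo)]
  refine lintegral_congr_ae ?_
  filter_upwards [hrank] with Z hZ
  simp only [Pi.mul_apply]
  rw [stiefelOrientation_eq h hZ, mul_comm]

/-- The law of the orientation of a normal matrix has the density `cmacgDensity` with respect to
the normalized invariant measure. -/
lemma cmacg_eq_map_withDensity {m r : ℕ} (h : r ≤ m) {P : Matrix (Fin m) (Fin m) ℂ}
    (hP : P.PosDef) :
    cmacg m r P = ((stiefelMeasure h).withDensity
      (fun X => ENNReal.ofReal (cmacgDensity P X.1))).map Subtype.val := by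
  have mo := measurable_orientation m r
  have mwR := measurable_gaussWeight (r := r) P⁻¹
  have mgR := measurable_gramDet (r := r) P⁻¹
  have hdet : 0 < P.det.re := (Complex.pos_iff.mp hP.det_pos).1
  have hpi : ENNReal.ofReal (Real.pi ^ (m * r)) ≠ 0 :=
    (ENNReal.ofReal_pos.mpr (by positivity)).ne'
  ext A hA
  have hψ : Measurable (A.indicator (1 : Matrix (Fin m) (Fin r) ℂ → ℝ≥0∞)) :=
    measurable_one.indicator hA
  have hf : Measurable fun X : Matrix (Fin m) (Fin r) ℂ =>
      A.indicator 1 X * ENNReal.ofReal ((gramDet P⁻¹ X ^ m)⁻¹) := by fun_prop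
  have h1 : cmacg m r P A = ENNReal.ofReal ((Real.pi ^ (m * r))⁻¹ * (P.det.re ^ r)⁻¹) *
      ∫⁻ Z : Matrix (Fin m) (Fin r) ℂ, A.indicator 1 (orientation Z) * gaussWeight P⁻¹ Z := by
    rw [cmacg, Measure.map_apply mo hA, complexMatrixNormal, withDensity_apply _ (mo hA),
      ← lintegral_indicator (mo hA), ← lintegral_const_mul' _ _ ENNReal.ofReal_ne_top]
    refine lintegral_congr fun Z => ?_
    by_cases hZ : orientation Z ∈ A
    · simp only [Set.indicator, Set.mem_preimage, hZ, if_true, Pi.one_apply, one_mul, gaussWeight]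
      rw [← ENNReal.ofReal_mul (by positivity)]
    · simp [Set.indicator, hZ]
  have h2 : ((stiefelMeasure h).withDensity
      (fun X => ENNReal.ofReal (cmacgDensity P X.1))).map Subtype.val A =
      ENNReal.ofReal ((P.det.re ^ r)⁻¹) *
        ∫⁻ X, A.indicator 1 X.1 * ENNReal.ofReal ((gramDet P⁻¹ X.1 ^ m)⁻¹) ∂stiefelMeasure h := by
    rw [Measure.map_apply measurable_subtype_coe hA,
      withDensity_apply _ (measurable_subtype_coe hA),
      ← lintegral_indicator (measurable_subtype_coe hA),
      ← lintegral_const_mul' _ _ ENNReal.ofReal_ne_top]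
    refine lintegral_congr fun X => ?_
    by_cases hX : X.1 ∈ A
    · simp only [Set.indicator, Set.mem_preimage, hX, if_true, Pi.one_apply, one_mul, cmacgDensity,
        gramDet]
      rw [ENNReal.ofReal_mul (by positivity)]
    · simp [Set.indicator, hX]
  have h3 : ∫⁻ Z : Matrix (Fin m) (Fin r) ℂ, A.indicator 1 (orientation Z) * gaussWeight P⁻¹ Z =
      ENNReal.ofReal (Real.pi ^ (m * r)) *
        ∫⁻ X, A.indicator 1 X.1 * ENNReal.ofReal ((gramDet P⁻¹ X.1 ^ m)⁻¹) ∂stiefelMeasure h := by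
    rw [lintegral_orientation_mul_gaussWeight h hP.inv hψ,
      ← lintegral_orientation_mul_gaussWeight_one h hf]
    refine lintegral_congr fun Z => ?_
    rw [gramDet_orientation, mul_pow, mul_inv, inv_pow, inv_inv]
    ring
  rw [h1, h2, h3, ENNReal.ofReal_mul (by positivity), ENNReal.ofReal_inv_of_pos (by positivity)]
  calc _ = ((ENNReal.ofReal (Real.pi ^ (m * r)))⁻¹ * ENNReal.ofReal (Real.pi ^ (m * r))) *
        (ENNReal.ofReal ((P.det.re ^ r)⁻¹) *
          ∫⁻ X, A.indicator 1 X.1 * ENNReal.ofReal ((gramDet P⁻¹ X.1 ^ m)⁻¹) ∂stiefelMeasure h) := by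
        ring
    _ = _ := by rw [ENNReal.inv_mul_cancel hpi ENNReal.ofReal_ne_top, one_mul]

end CMACG

end

theorem mainTheorem1 {m r : ℕ} (h : r ≤ m)
    (P : Matrix (Fin m) (Fin m) ℂ) (hP : P.PosDef)
    {Ω : Type*} [MeasurableSpace Ω] (μ : Measure Ω) [IsProbabilityMeasure μ]
    (Z : Ω → Matrix (Fin m) (Fin r) ℂ)
    (hZ : HasLaw Z (CMACG.complexMatrixNormal m r P) μ) :
    (∀ᵐ ω ∂μ, (Z ω).rank = r ∧ CMACG.orientation (Z ω) ∈ CMACG.stiefel m r) ∧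
    HasLaw (fun ω => CMACG.orientation (Z ω)) (CMACG.cmacg m r P) μ ∧
    CMACG.cmacg m r P =
      ((CMACG.stiefelMeasure h).withDensity
        (fun X => ENNReal.ofReal (CMACG.cmacgDensity P X.1))).map Subtype.val := by
  have mo := CMACG.measurable_orientation m r
  refine ⟨?_, ⟨mo.comp_aemeasurable hZ.aemeasurable, ?_⟩, CMACG.cmacg_eq_map_withDensity h hP⟩
  · have hae : ∀ᵐ W ∂CMACG.complexMatrixNormal m r P, (Wᴴ * W).det ≠ 0 :=
      (withDensity_absolutelyContinuous _ _).ae_le (CMACG.ae_det_conjTranspose_mul_self_ne_zero h)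
    rw [← hZ.map_eq] at hae
    filter_upwards [ae_of_ae_map hZ.aemeasurable hae] with ω hω
    refine ⟨?_, CMACG.orientation_mem_stiefel hω⟩
    rw [← rank_conjTranspose_mul_self,
      rank_of_isUnit _ ((Matrix.isUnit_iff_isUnit_det _).mpr hω.isUnit), Fintype.card_fin]
  · rw [CMACG.cmacg, ← hZ.map_eq, AEMeasurable.map_map_of_aemeasurable mo.aemeasurable
      hZ.aemeasurable]
    rfl
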